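/- All rings are commutative with identity. Let $R=\bigoplus_{n\ge 0}R_n$ be an $\mathbb N$-graded ring with $R_0=k$ a field. Assume that $R$ is a Hilbert–Serre ring, that is: 1. $\dim_k R_n<\infty$ for all $n\in\mathbb N$; 2. the Poincaré series $P_R(t)=\sum_{n\ge 0}(\dim_k R_n)\,t^n$ has radius of convergence at least $1$ (it is then equal to $1$ unless $R_n=0$ for all sufficiently large $n$); 3. the set $D$ of all $d\in\mathbb N$ for which $\lim_{t\to 1^-}(1-t)^dP_R(t)$ exists and is finite is not empty. Put $d(R)=\min D$. Let $\dim(R)$ be the Krull dimension of $R$, and let $$\operatorname{GKdim}_k(R)=\sup_V\ \limsup_{n\to\infty}\frac{\log\bigl(\dim_k(k+V+\cdots+V^n)\bigr)}{\log n}$$ be the Gelfand–Kirillov dimension of $R$, where $V$ ranges over all finite-dimensional $k$-subspaces of $R$ and $V^i$ is the $k$-subspace spanned by all products of $i$ elements of $V$. Then $$\dim(R)\le \operatorname{GKdim}_k(R)\le d(R).$$ If moreover $R$ is a domain, then $$\dim(R)\le \operatorname{trdeg}_k(R)=\operatorname{GKdim}_k(R)\le d(R),$$ where $\operatorname{trdeg}_k(R)$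 is the transcendence degree of $R$ over $k$. -/

import Mathlib

open Filter Topology
open scoped ENNReal

namespace HilbertSerre

noncomputable section

variable (k : Type*) {R : Type*} [Field k] [CommRing R] [Algebra k R]

/-- The `n`-th coefficient `dim_k R_n` of the Poincaré series of `R = ⨁ R_n`, as a real number. -/
def hilbertCoeff (𝒜 : ℕ → Submodule k R) (n : ℕ) : ℝ :=
  (Module.finrank k (𝒜 n) : ℝ)

/-- The value `P_R(t) = ∑ (dim_k R_n) t ^ n` of the Poincaré series at a real number `t`.
It is only used where the series converges. -/
def poincareSeries (𝒜 : ℕ → Submodule k R) (t : ℝ) : ℝ :=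
  ∑' n : ℕ, hilbertCoeff k 𝒜 n * t ^ n

/-- The set of all natural numbers `d` for which `(1 - t) ^ d * P_R(t)` has a finite limit
as `t` tends to `1` from the left. -/
def poleOrders (𝒜 : ℕ → Submodule k R) : Set ℕ :=
  {d | ∃ L : ℝ, Tendsto (fun t : ℝ => (1 - t) ^ d * poincareSeries k 𝒜 t) (𝓝[<] 1) (𝓝 L)}

/-- The conditions that make the graded ring `R = ⨁ R_n` with `R_0 = k` a Hilbert-Serre ring.
The radius of convergence of the Poincaré series is required to be at least `1`: it equals `1`
unless `R_n = 0` for all large `n`, in which case the series is a polynomial. -/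
structure IsHilbertSerre (𝒜 : ℕ → Submodule k R) : Prop where
  finiteDimensional : ∀ n, FiniteDimensional k (𝒜 n)
  one_le_radius : 1 ≤ (FormalMultilinearSeries.ofScalars ℝ (hilbertCoeff k 𝒜)).radius
  poleOrders_nonempty : (poleOrders k 𝒜).Nonempty

/-- The Hilbert-Serre dimension `d(R)`: the least element of `poleOrders`. -/
def hilbertSerreDim (𝒜 : ℕ → Submodule k R) : ℕ :=
  sInf (poleOrders k 𝒜)

/-- The growth function `d_V(n) = dim_k (k + V + ⋯ + V ^ n)` of a subspace `V` of `R`.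
Here `V ^ i` is the span of all products of `i` elements of `V`, and `V ^ 0 = k`. -/
def growth (V : Submodule k R) (n : ℕ) : ℕ :=
  Module.finrank k (∑ i ∈ Finset.range (n + 1), V ^ i : Submodule k R)

variable (R)

/-- The Gelfand-Kirillov dimension of `R` over `k`: the supremum over all finite-dimensional
subspaces `V` of `limsup (log (d_V(n)) / log n)`, in the extended reals. -/
def gkDim : EReal :=
  ⨆ (V : Submodule k R) (_ : FiniteDimensional k V),
    limsup (fun n : ℕ => ((Real.log (growth k V n) / Real.log n : ℝ) : EReal)) atTop

/-- The transcendence degree of `R` over `k` in the extended reals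
(every infinite cardinal becomes `⊤`). -/
def trdegE : EReal :=
  (((Cardinal.toENat (Algebra.trdeg k R) : ℕ∞) : ℝ≥0∞) : EReal)

/-- The Krull dimension of a ring in the extended reals (`⊥` for the zero ring). -/
def krullDimE (S : Type*) [CommRing S] : EReal :=
  WithBot.recBotCoe ⊥ (fun n : ℕ∞ => ((n : ℝ≥0∞) : EReal)) (ringKrullDim S)

end

end HilbertSerre

/-! Algebraically independent elements link the invariants. A chain of `n + 1` primes yields `n`
elements independent modulo the smallest prime. The monomials in `m` independent elements make
growth at least a constant times `n ^ m`. Hence Krull dimension is at most transcendence degree and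
at most GK dimension.

Conversely, by Noether normalization `k[V]` is finite over a polynomial ring in `s` variables, so
`V` grows at most like `n ^ s`. The variables are independent in `R`, so in a domain GK dimension
equals transcendence degree.

For the bound by `d(R)`, `V` lies in bounded degrees, so `V ^ n` lies in degrees at most linear in
`n`; partial sums of the Hilbert function are controlled by the Poincaré series near `1`
(`IsHilbertSerre.sum_hilbertCoeff_le`). -/

/-! ### Sums, products and powers of subspaces -/

theorem Submodule.exists_le_of_monotone_of_finite {k M : Type*} [Field k] [AddCommGroup M]
    [Module k M] {W : ℕ → Submodule k M} (hW : Monotone W) (V : Submodule k M)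
    [FiniteDimensional k V] (h : ∀ v ∈ V, ∃ N, v ∈ W N) : ∃ N, V ≤ W N := by
  obtain ⟨s, rfl⟩ := (Submodule.fg_iff_finiteDimensional V).2 inferInstance
  choose! f hf using h
  refine ⟨s.sup f, Submodule.span_le.2 fun v hv => ?_⟩
  exact hW (Finset.le_sup (f := f) hv) (hf v (Submodule.subset_span hv))

theorem Submodule.sum_le_of_forall_le {k M ι : Type*} [Field k] [AddCommGroup M] [Module k M]
    {s : Finset ι} {f : ι → Submodule k M} {W : Submodule k M} (h : ∀ i ∈ s, f i ≤ W) :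
    ∑ i ∈ s, f i ≤ W :=
  Finset.sum_induction f (· ≤ W) (fun _ _ ha hb => sup_le ha hb) bot_le h

theorem Submodule.le_sum_of_mem {k M ι : Type*} [Field k] [AddCommGroup M] [Module k M]
    {s : Finset ι} (f : ι → Submodule k M) {i : ι} (hi : i ∈ s) : f i ≤ ∑ j ∈ s, f j := by
  classical
  rw [← Finset.add_sum_erase s f hi]
  exact le_sup_left

theorem Submodule.finiteDimensional_sum {k M ι : Type*} [Field k] [AddCommGroup M] [Module k M]
    {s : Finset ι} {f : ι → Submodule k M} (h : ∀ i ∈ s, FiniteDimensional k (f i)) :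
    FiniteDimensional k (∑ i ∈ s, f i : Submodule k M) :=
  Finset.sum_induction f (fun W => FiniteDimensional k W)
    (fun a b _ _ => Submodule.finiteDimensional_sup a b) (finiteDimensional_bot k M) h

theorem Submodule.finrank_sum_le {k M ι : Type*} [Field k] [AddCommGroup M] [Module k M]
    {s : Finset ι} {f : ι → Submodule k M} (h : ∀ i, FiniteDimensional k (f i)) :
    Module.finrank k (∑ i ∈ s, f i : Submodule k M) ≤ ∑ i ∈ s, Module.finrank k (f i) := by
  classical
  induction s using Finset.induction_on with
  | empty => rw [Finset.sum_empty, Finset.sum_empty]; exact (finrank_bot k M).le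
  | insert a s ha ih =>
    rw [Finset.sum_insert ha, Finset.sum_insert ha]
    have := Submodule.finiteDimensional_sum (s := s) (f := f) fun i _ => h i
    exact (Submodule.finrank_add_le_finrank_add_finrank _ _).trans (by gcongr)

theorem Submodule.finrank_mul_le_mul {k R : Type*} [Field k] [CommRing R] [Algebra k R]
    (P S : Submodule k R) [FiniteDimensional k P] [FiniteDimensional k S] :
    Module.finrank k (P * S : Submodule k R) ≤ Module.finrank k P * Module.finrank k S := by
  rw [← Submodule.mulMap_range, ← Module.finrank_tensorProduct]
  exact LinearMap.finrank_range_le _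

theorem Submodule.prod_pow_mem_pow_sum {k R ι : Type*} [Field k] [CommRing R] [Algebra k R]
    (V : Submodule k R) (x : ι → R) (hx : ∀ i, x i ∈ V) (e : ι → ℕ) (s : Finset ι) :
    ∏ i ∈ s, x i ^ e i ∈ V ^ ∑ i ∈ s, e i := by
  classical
  induction s using Finset.induction_on with
  | empty => exact Submodule.one_le.1 le_rfl
  | insert a s ha ih =>
    rw [Finset.prod_insert ha, Finset.sum_insert ha, pow_add]
    exact Submodule.mul_mem_mul (Submodule.pow_mem_pow _ (hx a) _) ih

/-! ### Polynomials of bounded degree in each variable -/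

namespace MvPolynomial

/-- Bounding each exponent separately makes the monomials a box, so this exact count serves both the
lower and the upper growth bounds. -/
theorem finrank_restrictDegree (k : Type*) [Field k] (m N : ℕ) :
    Module.finrank k (restrictDegree (Fin m) k N) = (N + 1) ^ m := by
  have e : {n : Fin m →₀ ℕ | ∀ i, n i ≤ N} ≃ (Fin m → Fin (N + 1)) :=
    { toFun := fun n i => ⟨n.1 i, Nat.lt_succ_of_le (n.2 i)⟩
      invFun := fun g => ⟨Finsupp.equivFunOnFinite.symm fun i => (g i : ℕ),
        fun i => Nat.le_of_lt_succ (g i).2⟩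
      left_inv := fun n => by ext; simp
      right_inv := fun g => by ext; simp }
  have h := Module.finrank_eq_nat_card_basis (basisRestrictSupport k {n : Fin m →₀ ℕ | ∀ i, n i ≤ N})
  rw [Nat.card_congr e] at h
  exact h.trans (by simp)

theorem restrictDegree_mono (σ k : Type*) [Field k] : Monotone (restrictDegree σ k) :=
  fun _ _ h => restrictSupport_mono k fun _ hn i => (hn i).trans h

theorem restrictDegree_mul_le (σ k : Type*) [Field k] (a b : ℕ) :
    restrictDegree σ k a * restrictDegree σ k b ≤ restrictDegree σ k (a + b) := by
  rw [restrictDegree, restrictDegree, ← restrictSupport_add]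
  refine restrictSupport_mono k ?_
  rintro _ ⟨x, hx, y, hy, rfl⟩ i
  exact add_le_add (hx i) (hy i)

theorem map_restrictDegree_mul_le {σ k R : Type*} [Field k] [CommRing R] [Algebra k R]
    (φ : MvPolynomial σ k →ₐ[k] R) (a b : ℕ) :
    (restrictDegree σ k a).map φ.toLinearMap * (restrictDegree σ k b).map φ.toLinearMap ≤
      (restrictDegree σ k (a + b)).map φ.toLinearMap := by
  rw [← Submodule.map_mul]
  exact Submodule.map_mono (restrictDegree_mul_le _ _ a b)

theorem one_le_map_restrictDegree {σ k R : Type*} [Field k] [CommRing R] [Algebra k R]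
    (φ : MvPolynomial σ k →ₐ[k] R) (N : ℕ) :
    1 ≤ (restrictDegree σ k N).map φ.toLinearMap := by
  refine Submodule.one_le.2 ⟨1, ?_, map_one φ⟩
  rw [← C_1, C_apply]
  exact (monomial_mem_restrictSupport k).2 (Or.inl fun i => by simp)

theorem exists_mem_restrictDegree {σ k : Type*} [Field k] (p : MvPolynomial σ k) :
    ∃ N, p ∈ restrictDegree σ k N :=
  ⟨p.totalDegree, restrictTotalDegree_le_restrictDegree _ _ _
    ((mem_restrictTotalDegree _ _ _).2 le_rfl)⟩

theorem aeval_cons_eq_eval₂ {k R : Type*} [Field k] [CommRing R] [Algebra k R] {n : ℕ}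
    (y : R) (x : Fin n → R) (f : MvPolynomial (Fin (n + 1)) k) :
    aeval (Fin.cons y x : Fin (n + 1) → R) f =
      Polynomial.eval₂ (aeval x : MvPolynomial (Fin n) k →ₐ[k] R).toRingHom y
        (finSuccEquiv k n f) := by
  induction f using MvPolynomial.induction_on with
  | C a => simp [finSuccEquiv_apply]
  | add p q hp hq => rw [map_add, map_add, Polynomial.eval₂_add, hp, hq]
  | mul_X p i hp =>
    rw [map_mul, map_mul, Polynomial.eval₂_mul, hp]
    congr 1
    refine Fin.cases ?_ (fun j => ?_) i
    · simp [finSuccEquiv_X_zero]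
    · simp [finSuccEquiv_X_succ]

end MvPolynomial

/-! ### Chains of primes and algebraic independence -/

/-- If `y ∈ Q` lies outside the prime `P ≤ Q` and no nonzero element of `A` maps into `Q`, then no
nonzero polynomial over `A` takes a value in `P` at `y`. -/
theorem Polynomial.eq_zero_of_eval₂_mem {A R : Type*} [CommRing A] [CommRing R] (φ : A →+* R)
    {P Q : Ideal R} [P.IsPrime] (hPQ : P ≤ Q) (hφ : ∀ a, φ a ∈ Q → a = 0) {y : R} (hyQ : y ∈ Q)
    (hyP : y ∉ P) (F : Polynomial A) (hF : F.eval₂ φ y ∈ P) : F = 0 := by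
  induction h : F.natDegree using Nat.strong_induction_on generalizing F with
  | _ n ih =>
  -- Since `y` and `F(y)` lie in `Q`, so does the constant term, which therefore vanishes. Then `y`
  -- can be cancelled modulo `P`, lowering the degree.
  have hdiv := F.divX_mul_X_add
  have hev : F.eval₂ φ y = F.divX.eval₂ φ y * y + φ (F.coeff 0) := by
    conv_lhs => rw [← hdiv]
    simp
  have h0 : F.coeff 0 = 0 := by
    refine hφ _ ?_
    have : φ (F.coeff 0) = F.eval₂ φ y - F.divX.eval₂ φ y * y := by rw [hev]; ring
    rw [this]
    exact Q.sub_mem (hPQ hF) (Q.mul_mem_left _ hyQ)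
  rw [hev, h0, map_zero, add_zero] at hF
  have hd := (Ideal.IsPrime.mem_or_mem ‹_› hF).resolve_right hyP
  rcases Nat.eq_zero_or_pos n with rfl | hn
  · rw [Polynomial.eq_C_of_natDegree_eq_zero h, h0, map_zero]
  · have := ih _ (by rw [Polynomial.natDegree_divX_eq_natDegree_tsub_one, h]; omega) _ hd rfl
    rw [← hdiv, this, h0]; simp

/-- Independence modulo `p 0` is what the induction needs: a family independent modulo `p 1` stays
so modulo `p 0` after adjoining any `y` in `p 1` outside `p 0`. -/
theorem PrimeSpectrum.exists_forall_aeval_mem_imp_eq_zero (k : Type*) {R : Type*} [Field k]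
    [CommRing R] [Algebra k R] (n : ℕ) (p : Fin (n + 1) → PrimeSpectrum R) (hp : StrictMono p) :
    ∃ x : Fin n → R, ∀ f : MvPolynomial (Fin n) k,
      MvPolynomial.aeval x f ∈ (p 0).asIdeal → f = 0 := by
  induction n with
  | zero =>
    refine ⟨Fin.elim0, fun f hf => ?_⟩
    obtain ⟨c, rfl⟩ := MvPolynomial.C_surjective (Fin 0) f
    by_contra hc
    have hc' : c ≠ 0 := fun h => hc (by rw [h, map_zero])
    rw [MvPolynomial.algHom_C] at hf
    exact (p 0).isPrime.ne_top
      (Ideal.eq_top_of_isUnit_mem _ hf ((IsUnit.mk0 c hc').map (algebraMap k R)))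
  | succ n ih =>
    obtain ⟨x, hx⟩ := ih (fun i => p i.succ) (hp.comp Fin.strictMono_succ)
    have hlt : (p 0).asIdeal < (p 1).asIdeal := hp (by simp)
    obtain ⟨y, hy1, hy0⟩ := SetLike.exists_of_lt hlt
    refine ⟨Fin.cons y x, fun f hf => ?_⟩
    rw [MvPolynomial.aeval_cons_eq_eval₂] at hf
    have := Polynomial.eq_zero_of_eval₂_mem _ hlt.le hx hy1 hy0 _ hf
    simpa using this

theorem exists_algebraicIndependent_of_le_ringKrullDim (k : Type*) {R : Type*} [Field k]
    [CommRing R] [Algebra k R] {n : ℕ} (hn : (n : WithBot ℕ∞) ≤ ringKrullDim R) :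
    ∃ x : Fin n → R, AlgebraicIndependent k x := by
  obtain ⟨l, rfl⟩ := Order.le_krullDim_iff.1 hn
  obtain ⟨x, hx⟩ := PrimeSpectrum.exists_forall_aeval_mem_imp_eq_zero k l.length l l.strictMono
  exact ⟨x, algebraicIndependent_iff.2 fun f hf => hx f (hf ▸ zero_mem _)⟩

/-! ### Growth of finite-dimensional subspaces -/

namespace HilbertSerre

section Growth

variable {k R : Type*} [Field k] [CommRing R] [Algebra k R]

theorem limsup_log_growth_le (V : Submodule k R) {C : ℝ} (hC : 1 ≤ C) (m : ℕ)
    (h : ∀ᶠ n : ℕ in atTop, (growth k V n : ℝ) ≤ C * (n : ℝ) ^ m) :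
    limsup (fun n : ℕ => ((Real.log (growth k V n) / Real.log n : ℝ) : EReal)) atTop ≤
      ((m : ℝ) : EReal) := by
  have hlog : Tendsto (fun n : ℕ => Real.log (n : ℝ)) atTop atTop :=
    Real.tendsto_log_atTop.comp tendsto_natCast_atTop_atTop
  have hlim : Tendsto (fun n : ℕ => ((Real.log C / Real.log n + m : ℝ) : EReal)) atTop
      (𝓝 ((m : ℝ) : EReal)) := by
    refine (continuous_coe_real_ereal.tendsto _).comp ?_
    simpa using (hlog.const_div_atTop (Real.log C)).add_const (m : ℝ)
  rw [← hlim.limsup_eq]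
  refine limsup_le_limsup ?_
  filter_upwards [h, eventually_gt_atTop 1] with n hn hn1
  have hn1' : (1 : ℝ) < n := by exact_mod_cast hn1
  have hl : 0 < Real.log n := Real.log_pos hn1'
  refine EReal.coe_le_coe_iff.2 ?_
  rw [div_le_iff₀ hl, add_mul, div_mul_cancel₀ _ hl.ne']
  have hmul : Real.log (C * (n : ℝ) ^ m) = Real.log C + m * Real.log n := by
    rw [Real.log_mul (by positivity) (by positivity), Real.log_pow]
  rw [← hmul]
  -- If the growth is `0`, its logarithm is `0` by convention, and `1 ≤ C` is needed.
  rcases (Nat.cast_nonneg (growth k V n) : (0 : ℝ) ≤ _).eq_or_lt with h0 | h0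
  · rw [← h0, Real.log_zero]
    exact Real.log_nonneg (one_le_mul_of_one_le_of_one_le hC (one_le_pow₀ hn1'.le))
  · exact Real.log_le_log h0 hn

theorem le_limsup_log_growth (V : Submodule k R) {c : ℝ} (hc : 0 < c) (m : ℕ)
    (h : ∀ᶠ n : ℕ in atTop, c * (n : ℝ) ^ m ≤ (growth k V n : ℝ)) :
    ((m : ℝ) : EReal) ≤
      limsup (fun n : ℕ => ((Real.log (growth k V n) / Real.log n : ℝ) : EReal)) atTop := by
  have hlog : Tendsto (fun n : ℕ => Real.log (n : ℝ)) atTop atTop :=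
    Real.tendsto_log_atTop.comp tendsto_natCast_atTop_atTop
  have hlim : Tendsto (fun n : ℕ => ((Real.log c / Real.log n + m : ℝ) : EReal)) atTop
      (𝓝 ((m : ℝ) : EReal)) := by
    refine (continuous_coe_real_ereal.tendsto _).comp ?_
    simpa using (hlog.const_div_atTop (Real.log c)).add_const (m : ℝ)
  rw [← hlim.limsup_eq]
  refine limsup_le_limsup ?_
  filter_upwards [h, eventually_gt_atTop 1] with n hn hn1
  have hn1' : (1 : ℝ) < n := by exact_mod_cast hn1
  have hl : 0 < Real.log n := Real.log_pos hn1'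
  refine EReal.coe_le_coe_iff.2 ?_
  rw [le_div_iff₀ hl, add_mul, div_mul_cancel₀ _ hl.ne', ← Real.log_pow,
    ← Real.log_mul (by positivity) (by positivity)]
  exact Real.log_le_log (by positivity) hn

theorem finiteDimensional_pow (V : Submodule k R) [FiniteDimensional k V] (n : ℕ) :
    FiniteDimensional k (V ^ n : Submodule k R) :=
  (Submodule.fg_iff_finiteDimensional _).1
    (((Submodule.fg_iff_finiteDimensional V).2 inferInstance).pow n)

theorem growth_le_finrank {V W : Submodule k R} [FiniteDimensional k W] {n : ℕ}
    (h : ∀ i ≤ n, V ^ i ≤ W) : growth k V n ≤ Module.finrank k W :=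
  Submodule.finrank_mono (Submodule.sum_le_of_forall_le fun i hi =>
    h i (Nat.le_of_lt_succ (Finset.mem_range.1 hi)))

/-- Monomials with all exponents at most `q` have total degree at most `m * q ≤ n`, and independence
keeps their images linearly independent. -/
theorem pow_le_growth_span_range {m : ℕ} {x : Fin m → R} (hx : AlgebraicIndependent k x)
    {q n : ℕ} (hq : m * q ≤ n) :
    (q + 1) ^ m ≤ growth k (Submodule.span k (Set.range x)) n := by
  set V := Submodule.span k (Set.range x)
  have : FiniteDimensional k V := FiniteDimensional.span_of_finite k (Set.finite_range x)
  rw [← MvPolynomial.finrank_restrictDegree k m q,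
    (Submodule.equivMapOfInjective (MvPolynomial.aeval x).toLinearMap hx _).finrank_eq]
  have := Submodule.finiteDimensional_sum (s := Finset.range (n + 1)) (f := fun i => V ^ i)
    fun i _ => finiteDimensional_pow V i
  refine Submodule.finrank_mono ?_
  rw [MvPolynomial.restrictDegree, MvPolynomial.restrictSupport_eq_span, Submodule.map_span,
    Submodule.span_le]
  rintro _ ⟨_, ⟨e, he, rfl⟩, rfl⟩
  have hle : ∑ i, e i ≤ n := by
    refine le_trans ?_ hq
    simpa using Finset.sum_le_card_nsmul Finset.univ e q fun i _ => he i
  have hmem := Submodule.prod_pow_mem_pow_sum V x (fun i => Submodule.subset_span ⟨i, rfl⟩) e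
    Finset.univ
  have := Submodule.le_sum_of_mem (fun i => V ^ i)
    (Finset.mem_range.2 (Nat.lt_succ_of_le hle)) hmem
  simpa [MvPolynomial.aeval_monomial, Finsupp.prod_fintype] using this

theorem le_gkDim_of_algebraicIndependent {m : ℕ} {x : Fin m → R}
    (hx : AlgebraicIndependent k x) : ((m : ℝ) : EReal) ≤ gkDim k R := by
  set V := Submodule.span k (Set.range x)
  have hfin : FiniteDimensional k V := FiniteDimensional.span_of_finite k (Set.finite_range x)
  refine le_trans ?_ (le_iSup₂ (f := fun (V : Submodule k R) (_ : FiniteDimensional k V) =>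
    limsup (fun n : ℕ => ((Real.log (growth k V n) / Real.log n : ℝ) : EReal)) atTop) V hfin)
  -- The box has `q = n / m` rounded down, and `q + 1` is at least the real quotient. For `m = 0`
  -- the constant is `0 ^ 0 = 1`.
  have hc : 0 < ((m : ℝ)⁻¹) ^ m := by
    rcases Nat.eq_zero_or_pos m with rfl | hm
    · simp
    · positivity
  refine le_limsup_log_growth V hc m (Eventually.of_forall fun n => ?_)
  have h1 := pow_le_growth_span_range hx (Nat.mul_div_le n m)
  have h2 : (m : ℝ)⁻¹ * n ≤ ((n / m + 1 : ℕ) : ℝ) := by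
    rw [inv_mul_eq_div, ← Nat.floor_div_eq_div (K := ℝ)]
    exact (by exact_mod_cast (Nat.lt_floor_add_one ((n : ℝ) / m)).le)
  calc ((m : ℝ)⁻¹) ^ m * (n : ℝ) ^ m = ((m : ℝ)⁻¹ * n) ^ m := (mul_pow _ _ _).symm
    _ ≤ ((n / m + 1 : ℕ) : ℝ) ^ m := by gcongr
    _ ≤ _ := by exact_mod_cast h1

/-- A finite-dimensional space of elements of an algebra `A` that is finite over a polynomial ring
in `s` variables has growth of degree at most `s`. -/
theorem exists_growth_le_mul_pow {s : ℕ} (φ : MvPolynomial (Fin s) k →ₐ[k] R)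
    (A : Subalgebra k R) (S : Submodule k R) [FiniteDimensional k S]
    (hSA : S ≤ Subalgebra.toSubmodule A)
    (hA : ∀ a ∈ A, ∃ N, a ∈ (MvPolynomial.restrictDegree (Fin s) k N).map φ.toLinearMap * S)
    (V : Submodule k R) [FiniteDimensional k V] (hVA : V ≤ Subalgebra.toSubmodule A) :
    ∃ C : ℝ, 1 ≤ C ∧ ∀ᶠ n : ℕ in atTop, (growth k V n : ℝ) ≤ C * (n : ℝ) ^ s := by
  set P : ℕ → Submodule k R := fun N =>
    (MvPolynomial.restrictDegree (Fin s) k N).map φ.toLinearMap with hP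
  have hPmono : Monotone P := fun a b h =>
    Submodule.map_mono (MvPolynomial.restrictDegree_mono _ _ h)
  have hPmul (a b : ℕ) : P a * P b ≤ P (a + b) :=
    MvPolynomial.map_restrictDegree_mul_le φ a b
  have hmono : Monotone fun N => P N * S := fun a b h => mul_le_mul_left (hPmono h) _
  have hVS : FiniteDimensional k (V * S : Submodule k R) :=
    (Submodule.fg_iff_finiteDimensional _).1
      (((Submodule.fg_iff_finiteDimensional V).2 inferInstance).mul
        ((Submodule.fg_iff_finiteDimensional S).2 inferInstance))
  obtain ⟨d, hd⟩ := Submodule.exists_le_of_monotone_of_finite hmono (V * S) fun v hv =>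
    hA v ((Submodule.mul_le.2 fun a ha b hb => A.mul_mem (hVA ha) (hSA hb) :
      V * S ≤ Subalgebra.toSubmodule A) hv)
  -- `S` need not contain `1`; the shift `e` turns the bound on `V ^ n * S` into one on `V ^ n`.
  obtain ⟨e, he⟩ := hA 1 A.one_mem
  have he' : (1 : Submodule k R) ≤ P e * S := Submodule.one_le.2 he
  have hpow (n : ℕ) : V ^ n * S ≤ P (d * n) * S := by
    induction n with
    | zero =>
      rw [pow_zero]
      exact mul_le_mul_left (MvPolynomial.one_le_map_restrictDegree φ _) _
    | succ n ih =>
      calc V ^ (n + 1) * S = V * (V ^ n * S) := by rw [pow_succ', mul_assoc]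
        _ ≤ V * (P (d * n) * S) := mul_le_mul_right ih _
        _ = P (d * n) * (V * S) := mul_left_comm _ _ _
        _ ≤ P (d * n) * (P d * S) := mul_le_mul_right hd _
        _ = P (d * n) * P d * S := (mul_assoc _ _ _).symm
        _ ≤ P (d * (n + 1)) * S := mul_le_mul_left (hPmul _ _) _
  have hVn (n : ℕ) : V ^ n ≤ P (d * n + e) * S :=
    calc V ^ n = V ^ n * 1 := (mul_one _).symm
      _ ≤ V ^ n * (P e * S) := mul_le_mul_right he' _
      _ = P e * (V ^ n * S) := mul_left_comm _ _ _
      _ ≤ P e * (P (d * n) * S) := mul_le_mul_right (hpow n) _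
      _ = P (d * n) * P e * S := by rw [← mul_assoc, mul_comm (P e)]
      _ ≤ P (d * n + e) * S := mul_le_mul_left (hPmul _ _) _
  have hPfin (N : ℕ) : FiniteDimensional k (P N) := Module.Finite.map _ _
  have hPrank (N : ℕ) : Module.finrank k (P N) ≤ (N + 1) ^ s :=
    (Submodule.finrank_map_le _ _).trans_eq (MvPolynomial.finrank_restrictDegree k s N)
  have hgrowth (n : ℕ) : growth k V n ≤ (d * n + e + 1) ^ s * Module.finrank k S := by
    have : FiniteDimensional k (P (d * n + e) * S : Submodule k R) :=
      (Submodule.fg_iff_finiteDimensional _).1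
        (((Submodule.fg_iff_finiteDimensional _).2 (hPfin _)).mul
          ((Submodule.fg_iff_finiteDimensional S).2 inferInstance))
    refine (growth_le_finrank fun i hi => (hVn i).trans (hmono ?_)).trans
      ((Submodule.finrank_mul_le_mul _ _).trans (Nat.mul_le_mul_right _ (hPrank _)))
    gcongr
  -- For `n ≥ 1`, `d * n + e + 1 ≤ (d + e + 1) * n`. The `+ 1` after the rank of `S` ensures `1 ≤
  -- C`.
  refine ⟨((d + e + 1 : ℕ) : ℝ) ^ s * (Module.finrank k S + 1), ?_, ?_⟩
  · refine one_le_mul_of_one_le_of_one_le (one_le_pow₀ ?_) (by simp)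
    exact_mod_cast Nat.le_add_left 1 (d + e)
  · filter_upwards [eventually_ge_atTop 1] with n hn
    have h1 : d * n + e + 1 ≤ (d + e + 1) * n := by nlinarith
    have h2 : growth k V n ≤ (d + e + 1) ^ s * (Module.finrank k S + 1) * n ^ s :=
      calc growth k V n ≤ (d * n + e + 1) ^ s * Module.finrank k S := hgrowth n
        _ ≤ ((d + e + 1) * n) ^ s * (Module.finrank k S + 1) := by gcongr; omega
        _ = _ := by rw [mul_pow]; ring
    exact_mod_cast h2

theorem exists_algebraicIndependent_limsup_le [Nontrivial R] (V : Submodule k R)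
    [FiniteDimensional k V] :
    ∃ (s : ℕ) (x : Fin s → R), AlgebraicIndependent k x ∧
      limsup (fun n : ℕ => ((Real.log (growth k V n) / Real.log n : ℝ) : EReal)) atTop ≤
        ((s : ℝ) : EReal) := by
  obtain ⟨t, ht⟩ := (Submodule.fg_iff_finiteDimensional V).2 ‹_›
  set A := Algebra.adjoin k (t : Set R)
  have : Algebra.FiniteType k A := (Subalgebra.fg_iff_finiteType A).1 ⟨t, rfl⟩
  obtain ⟨s, g, hg, hgfin⟩ := exists_finite_inj_algHom_of_fg k A
  set φ := A.val.comp g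
  have hφinj : Function.Injective φ := Subtype.val_injective.comp hg
  refine ⟨s, fun i => φ (MvPolynomial.X i), ?_, ?_⟩
  · have : MvPolynomial.aeval (fun i => φ (MvPolynomial.X i)) = φ :=
      MvPolynomial.algHom_ext fun i => by simp
    rw [AlgebraicIndependent, this]
    exact hφinj
  replace hgfin : g.toRingHom.Finite := hgfin
  algebraize [g.toRingHom]
  obtain ⟨u, hu⟩ := (Module.Finite.fg_top : (⊤ : Submodule (MvPolynomial (Fin s) k) A).FG)
  let S := Submodule.span k (A.val '' (u : Set A))
  have hSfin : FiniteDimensional k S :=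
    FiniteDimensional.span_of_finite k (u.finite_toSet.image _)
  have hmono : Monotone fun N =>
      (MvPolynomial.restrictDegree (Fin s) k N).map φ.toLinearMap * S := fun a b h =>
    mul_le_mul_left (Submodule.map_mono (MvPolynomial.restrictDegree_mono _ _ h)) _
  obtain ⟨C, hC, h⟩ := exists_growth_le_mul_pow φ A S (Submodule.span_le.2 (by
      rintro _ ⟨a, -, rfl⟩
      exact a.2)) (fun a ha => by
    have hmem : (⟨a, ha⟩ : A) ∈ Submodule.span (MvPolynomial (Fin s) k) (u : Set A) := by
      rw [hu]; trivial
    suffices ∀ b : A, b ∈ Submodule.span (MvPolynomial (Fin s) k) (u : Set A) → ∃ N, (b : R) ∈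
        (MvPolynomial.restrictDegree (Fin s) k N).map φ.toLinearMap * S from this _ hmem
    intro b hb
    -- Sums take the larger degree bound; multiplying by a polynomial adds its own.
    induction hb using Submodule.span_induction with
    | mem b hb =>
      have hbS : (b : R) ∈ S := Submodule.subset_span ⟨b, hb, rfl⟩
      have := Submodule.mul_mem_mul
        (Submodule.one_le.1 (MvPolynomial.one_le_map_restrictDegree φ 0)) hbS
      exact ⟨0, by rwa [one_mul] at this⟩
    | zero => exact ⟨0, zero_mem _⟩
    | add b c _ _ hb hc =>
      obtain ⟨N, hN⟩ := hb
      obtain ⟨M, hM⟩ := hc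
      exact ⟨max N M, add_mem (hmono (le_max_left N M) hN) (hmono (le_max_right N M) hM)⟩
    | smul p b _ hb =>
      obtain ⟨N, hN⟩ := hb
      obtain ⟨M, hM⟩ := MvPolynomial.exists_mem_restrictDegree p
      have hpb : ((p • b : A) : R) = φ p * b := rfl
      refine ⟨M + N, mul_le_mul_left (MvPolynomial.map_restrictDegree_mul_le φ M N) S ?_⟩
      rw [mul_assoc, hpb]
      exact Submodule.mul_mem_mul ⟨p, hM, rfl⟩ hN) V (by
    rw [← ht]
    exact Submodule.span_le.2 Algebra.subset_adjoin)
  exact limsup_log_growth_le V hC s h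

end Growth

end HilbertSerre

/-! ### Comparison of Krull dimension, transcendence degree and GK dimension -/

namespace HilbertSerre

section Comparison

theorem coe_enat_natCast (n : ℕ) : (((n : ℕ∞) : ℝ≥0∞) : EReal) = ((n : ℝ) : EReal) := by
  rw [ENat.toENNReal_coe, ← ENNReal.coe_natCast, EReal.coe_nnreal_eq_coe_real, NNReal.coe_natCast]

theorem krullDimE_le {S : Type*} [CommRing S] {y : EReal}
    (h : ∀ n : ℕ, (n : WithBot ℕ∞) ≤ ringKrullDim S → ((n : ℝ) : EReal) ≤ y) :
    krullDimE S ≤ y := by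
  unfold krullDimE
  induction hd : ringKrullDim S using WithBot.recBotCoe with
  | bot => exact bot_le
  | coe d =>
    rw [hd] at h
    induction d using ENat.recTopCoe with
    | top =>
      have : y = ⊤ := by
        refine EReal.eq_top_iff_forall_lt y |>.2 fun r => ?_
        obtain ⟨n, hn⟩ := exists_nat_gt r
        exact lt_of_lt_of_le (EReal.coe_lt_coe_iff.2 hn) (h n (by exact_mod_cast le_top))
      rw [this]; exact le_top
    | coe n => exact (coe_enat_natCast n).trans_le (h n le_rfl)

variable {k R : Type*} [Field k] [CommRing R] [Algebra k R]

theorem trdegE_le {y : EReal}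
    (h : ∀ n : ℕ, (n : ℕ∞) ≤ Cardinal.toENat (Algebra.trdeg k R) → ((n : ℝ) : EReal) ≤ y) :
    trdegE k R ≤ y := by
  unfold trdegE
  induction hd : Cardinal.toENat (Algebra.trdeg k R) using ENat.recTopCoe with
  | top =>
    rw [hd] at h
    have : y = ⊤ := by
      refine EReal.eq_top_iff_forall_lt y |>.2 fun r => ?_
      obtain ⟨n, hn⟩ := exists_nat_gt r
      exact lt_of_lt_of_le (EReal.coe_lt_coe_iff.2 hn) (h n le_top)
    rw [this]; exact le_top
  | coe n =>
    rw [hd] at h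
    exact (coe_enat_natCast n).trans_le (h n le_rfl)

theorem le_trdegE_of_algebraicIndependent {m : ℕ} {x : Fin m → R}
    (hx : AlgebraicIndependent k x) : ((m : ℝ) : EReal) ≤ trdegE k R := by
  have h1 := hx.lift_cardinalMk_le_trdeg
  have h2 : (m : Cardinal) ≤ Algebra.trdeg k R := by simpa using h1
  have h3 : (m : ℕ∞) ≤ Cardinal.toENat (Algebra.trdeg k R) := by
    simpa using Cardinal.toENat.monotone' h2
  have h4 : (((m : ℕ∞) : ℝ≥0∞) : EReal) ≤ trdegE k R :=
    EReal.coe_ennreal_le_coe_ennreal_iff.2 (ENat.toENNReal_le.2 h3)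
  exact (coe_enat_natCast m).symm.trans_le h4

theorem exists_algebraicIndependent_of_le_trdeg [IsDomain R] {n : ℕ}
    (hn : (n : ℕ∞) ≤ Cardinal.toENat (Algebra.trdeg k R)) :
    ∃ x : Fin n → R, AlgebraicIndependent k x := by
  obtain ⟨s, hs⟩ := exists_isTranscendenceBasis k R
  have hcard : (n : Cardinal) ≤ Cardinal.mk s := by
    rw [hs.cardinalMk_eq_trdeg]
    simpa using hn
  have : Cardinal.lift (Cardinal.mk (Fin n)) ≤ Cardinal.lift (Cardinal.mk s) := by
    simpa using hcard
  obtain ⟨f⟩ := Cardinal.lift_mk_le'.1 this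
  exact ⟨_, hs.1.comp f f.injective⟩

theorem krullDimE_le_gkDim : krullDimE R ≤ gkDim k R :=
  krullDimE_le fun n hn => by
    obtain ⟨x, hx⟩ := exists_algebraicIndependent_of_le_ringKrullDim k hn
    exact le_gkDim_of_algebraicIndependent hx

theorem krullDimE_le_trdegE : krullDimE R ≤ trdegE k R :=
  krullDimE_le fun n hn => by
    obtain ⟨x, hx⟩ := exists_algebraicIndependent_of_le_ringKrullDim k hn
    exact le_trdegE_of_algebraicIndependent hx

theorem trdegE_eq_gkDim [IsDomain R] : trdegE k R = gkDim k R := by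
  refine le_antisymm (trdegE_le fun n hn => ?_) (iSup₂_le fun V hV => ?_)
  · obtain ⟨x, hx⟩ := exists_algebraicIndependent_of_le_trdeg hn
    exact le_gkDim_of_algebraicIndependent hx
  · obtain ⟨s, x, hx, h⟩ := exists_algebraicIndependent_limsup_le V
    exact h.trans (le_trdegE_of_algebraicIndependent hx)

end Comparison

/-! ### Hilbert functions and the pole order at `1` -/

section Graded

variable {k R : Type*} [Field k] [CommRing R] [Algebra k R] (𝒜 : ℕ → Submodule k R)

theorem IsHilbertSerre.summable {𝒜 : ℕ → Submodule k R} (h : IsHilbertSerre k 𝒜) {t : ℝ}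
    (ht0 : 0 ≤ t) (ht1 : t < 1) : Summable fun n => hilbertCoeff k 𝒜 n * t ^ n := by
  lift t to NNReal using ht0
  have hlt : (t : ℝ≥0∞) < (FormalMultilinearSeries.ofScalars ℝ (hilbertCoeff k 𝒜)).radius :=
    lt_of_lt_of_le (by exact_mod_cast ht1) h.one_le_radius
  have := FormalMultilinearSeries.summable_norm_mul_pow _ hlt
  refine this.congr fun n => ?_
  have hn : 0 ≤ hilbertCoeff k 𝒜 n := Nat.cast_nonneg _
  rw [FormalMultilinearSeries.ofScalars_norm, Real.norm_of_nonneg hn]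

/-- Evaluate at `t = 1 - 1 / (2 * N)`. Bernoulli gives `t ^ N ≥ 1 / 2`, so by nonnegativity the
partial sum is at most twice the series, which is at most `(|L| + 1) * (2 * N) ^ d` for large `N`.
-/
theorem IsHilbertSerre.sum_hilbertCoeff_le {𝒜 : ℕ → Submodule k R} (h : IsHilbertSerre k 𝒜)
    {d : ℕ} (hd : d ∈ poleOrders k 𝒜) :
    ∃ C : ℝ, 1 ≤ C ∧ ∀ᶠ N : ℕ in atTop,
      ∑ i ∈ Finset.range (N + 1), hilbertCoeff k 𝒜 i ≤ C * (N : ℝ) ^ d := by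
  obtain ⟨L, hL⟩ := hd
  have hev := hL.eventually (eventually_le_nhds (b := |L| + 1) (lt_of_le_of_lt (le_abs_self L)
    (lt_add_one _)))
  have hseq : Tendsto (fun N : ℕ => 1 - 1 / (2 * (N : ℝ))) atTop (𝓝[<] 1) := by
    refine tendsto_nhdsWithin_iff.2 ⟨?_, ?_⟩
    · have h2 : Tendsto (fun N : ℕ => 2 * (N : ℝ)) atTop atTop :=
        tendsto_natCast_atTop_atTop.const_mul_atTop two_pos
      simpa using (h2.const_div_atTop 1).const_sub 1
    · filter_upwards [eventually_gt_atTop 0] with N hN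
      have : (0 : ℝ) < N := by exact_mod_cast hN
      simpa using this
  refine ⟨2 * (|L| + 1) * 2 ^ d, ?_, ?_⟩
  · have : (1 : ℝ) ≤ 2 ^ d := one_le_pow₀ one_le_two
    nlinarith [abs_nonneg L]
  filter_upwards [hseq.eventually hev, eventually_gt_atTop 0] with N hN hN0
  have hNpos : (0 : ℝ) < N := by exact_mod_cast hN0
  have hN1 : (1 : ℝ) ≤ N := by exact_mod_cast hN0
  set t : ℝ := 1 - 1 / (2 * (N : ℝ)) with ht
  have hsmall : 1 / (2 * (N : ℝ)) ≤ 1 / 2 := by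
    gcongr
    linarith
  have hpos : 0 < 1 / (2 * (N : ℝ)) := by positivity
  have ht0 : 0 ≤ t := by rw [ht]; linarith
  have ht1 : t < 1 := by rw [ht]; linarith
  have htN : 1 / 2 ≤ t ^ N := by
    have := one_add_mul_le_pow (a := -(1 / (2 * (N : ℝ)))) (by linarith) N
    have e : 1 + (N : ℝ) * -(1 / (2 * (N : ℝ))) = 1 / 2 := by field_simp; norm_num
    rwa [e, ← sub_eq_add_neg] at this
  have hcoeff (i : ℕ) : 0 ≤ hilbertCoeff k 𝒜 i := Nat.cast_nonneg _
  have hpartial : ∑ i ∈ Finset.range (N + 1), hilbertCoeff k 𝒜 i * t ^ i ≤ poincareSeries k 𝒜 t :=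
    (h.summable ht0 ht1).sum_le_tsum _ fun i _ => mul_nonneg (hcoeff i) (pow_nonneg ht0 i)
  have hterm : (∑ i ∈ Finset.range (N + 1), hilbertCoeff k 𝒜 i) * (1 / 2) ≤
      ∑ i ∈ Finset.range (N + 1), hilbertCoeff k 𝒜 i * t ^ i := by
    rw [Finset.sum_mul]
    refine Finset.sum_le_sum fun i hi => mul_le_mul_of_nonneg_left (htN.trans ?_) (hcoeff i)
    exact pow_le_pow_of_le_one ht0 ht1.le (Nat.le_of_lt_succ (Finset.mem_range.1 hi))
  have hP : poincareSeries k 𝒜 t ≤ (|L| + 1) * (2 * N) ^ d := by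
    have e : 1 - t = (2 * (N : ℝ))⁻¹ := by rw [ht]; ring
    rw [e, inv_pow, inv_mul_le_iff₀ (by positivity)] at hN
    linarith
  calc ∑ i ∈ Finset.range (N + 1), hilbertCoeff k 𝒜 i ≤ 2 * ((|L| + 1) * (2 * N) ^ d) := by
        linarith
    _ = 2 * (|L| + 1) * 2 ^ d * (N : ℝ) ^ d := by rw [mul_pow]; ring

theorem monotone_sum_range : Monotone fun N => ∑ i ∈ Finset.range (N + 1), 𝒜 i :=
  fun _ _ h => Submodule.sum_le_of_forall_le fun _ hi => Submodule.le_sum_of_mem 𝒜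
    (Finset.range_mono (Nat.succ_le_succ h) hi)

variable [GradedAlgebra 𝒜]

theorem sum_range_mul_le (a b : ℕ) :
    (∑ i ∈ Finset.range (a + 1), 𝒜 i) * (∑ i ∈ Finset.range (b + 1), 𝒜 i) ≤
      ∑ i ∈ Finset.range (a + b + 1), 𝒜 i := by
  rw [Finset.sum_mul_sum]
  refine Submodule.sum_le_of_forall_le fun i hi => Submodule.sum_le_of_forall_le fun j hj => ?_
  refine le_trans (Submodule.mul_le.2 fun x hx y hy => SetLike.mul_mem_graded hx hy)
    (Submodule.le_sum_of_mem 𝒜 (i := i + j) ?_)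
  simp only [Finset.mem_range] at *
  omega

theorem mem_sum_range (x : R) : ∃ N, x ∈ ∑ i ∈ Finset.range (N + 1), 𝒜 i := by
  classical
  refine ⟨((DirectSum.decompose 𝒜 x).support).sup id, ?_⟩
  nth_rw 2 [← DirectSum.sum_support_decompose 𝒜 x]
  refine Submodule.sum_mem _ fun i hi => ?_
  exact Submodule.le_sum_of_mem 𝒜 (Finset.mem_range.2 (Nat.lt_succ_of_le
    (Finset.le_sup (f := id) hi))) (SetLike.coe_mem _)

theorem IsHilbertSerre.gkDim_le (h : IsHilbertSerre k 𝒜) :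
    gkDim k R ≤ ((hilbertSerreDim k 𝒜 : ℝ) : EReal) := by
  obtain ⟨C, hC, hsum⟩ := h.sum_hilbertCoeff_le (Nat.sInf_mem h.poleOrders_nonempty)
  refine iSup₂_le fun V hV => ?_
  obtain ⟨m, hm⟩ := Submodule.exists_le_of_monotone_of_finite (monotone_sum_range 𝒜) V
    fun v _ => mem_sum_range 𝒜 v
  -- A positive bound `m + 1` makes `(m + 1) * n` tend to infinity, so the eventual estimate `hsum`
  -- applies along it.
  replace hm := hm.trans (monotone_sum_range 𝒜 (Nat.le_succ m))
  have hpow (n : ℕ) : V ^ n ≤ ∑ i ∈ Finset.range ((m + 1) * n + 1), 𝒜 i := by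
    induction n with
    | zero =>
      exact Submodule.one_le.2 (Submodule.le_sum_of_mem 𝒜 (Finset.mem_range.2 (Nat.succ_pos _))
        (SetLike.one_mem_graded 𝒜))
    | succ n ih =>
      rw [pow_succ]
      exact (mul_le_mul' ih hm).trans (sum_range_mul_le 𝒜 _ _)
  have hfin := h.finiteDimensional
  have hgrowth (n : ℕ) : (growth k V n : ℝ) ≤
      ∑ i ∈ Finset.range ((m + 1) * n + 1), hilbertCoeff k 𝒜 i := by
    have := Submodule.finiteDimensional_sum (s := Finset.range ((m + 1) * n + 1)) (f := 𝒜)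
      fun i _ => hfin i
    have h1 := (growth_le_finrank (V := V) (n := n) fun i hi =>
      (hpow i).trans (monotone_sum_range 𝒜 (Nat.mul_le_mul_left (m + 1) hi))).trans
      (Submodule.finrank_sum_le hfin)
    unfold hilbertCoeff
    exact_mod_cast h1
  have hsub : Tendsto (fun n : ℕ => (m + 1) * n) atTop atTop :=
    tendsto_id.const_mul_atTop' (Nat.succ_pos m)
  refine limsup_log_growth_le V (C := C * ((m + 1 : ℕ) : ℝ) ^ hilbertSerreDim k 𝒜)
    (one_le_mul_of_one_le_of_one_le hC (one_le_pow₀ (by simp))) _ ?_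
  filter_upwards [hsub.eventually hsum] with n hn
  refine (hgrowth n).trans (hn.trans_eq ?_)
  rw [Nat.cast_mul, mul_pow, mul_assoc]
  rfl

end Graded

end HilbertSerre

theorem theorem4p6 {k R : Type*} [Field k] [CommRing R] [Algebra k R]
    (𝒜 : ℕ → Submodule k R) [GradedAlgebra 𝒜]
    (h0 : Function.Bijective (algebraMap k (𝒜 0)))
    (hR : HilbertSerre.IsHilbertSerre k 𝒜) :
    (HilbertSerre.krullDimE R ≤ HilbertSerre.gkDim k R ∧
      HilbertSerre.gkDim k R ≤ ((HilbertSerre.hilbertSerreDim k 𝒜 : ℝ) : EReal)) ∧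
    (IsDomain R →
      HilbertSerre.krullDimE R ≤ HilbertSerre.trdegE k R ∧
      HilbertSerre.trdegE k R = HilbertSerre.gkDim k R ∧
      HilbertSerre.gkDim k R ≤ ((HilbertSerre.hilbertSerreDim k 𝒜 : ℝ) : EReal)) := by
  exact ⟨⟨HilbertSerre.krullDimE_le_gkDim, hR.gkDim_le⟩, fun _ =>
    ⟨HilbertSerre.krullDimE_le_trdegE, HilbertSerre.trdegE_eq_gkDim, hR.gkDim_le⟩⟩
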